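/- All graphs are finite and simple. For a graph $H$ and an integer $i\ge 1$, let $c_i(H)$ denote the number of connected components of $H$ having exactly $i$ vertices; for $X\subseteq V(G)$, let $G-X$ be the graph obtained from $G$ by deleting the vertices in $X$. Let $P_n$ be the path with $n$ vertices. A $\{P_2,P_7\}$-factor of $G$ is a spanning subgraph $F$ of $G$ such that each connected component of $F$ is isomorphic to $P_2$ or $P_7$. **Theorem.** Let $G$ be a graph. If $$c_1(G-X)+\tfrac13 c_3(G-X)+\tfrac13 c_5(G-X)\le \tfrac23|X|\quad\text{for all } X\subseteq V(G),$$ then $G$ has a $\{P_2,P_7\}$-factor. -/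

import Mathlib

namespace PathFactor

/-- The number `c_i(H)` of connected components of `H` with exactly `i` vertices. -/
noncomputable def numComponents {W : Type*} (H : SimpleGraph W) (i : ℕ) : ℕ :=
  {C : H.ConnectedComponent | C.supp.ncard = i}.ncard

/-- The graph `G - X` obtained from `G` by deleting the vertices in `X`. -/
abbrev deleteVerts {V : Type*} (G : SimpleGraph V) (X : Set V) : SimpleGraph (Xᶜ : Set V) :=
  G.induce Xᶜ

/-- `F` is an `𝓗`-factor of `G`: a spanning subgraph of `G` (a graph on the same vertex set, all
of whose edges are edges of `G`) each of whose components is isomorphic to a graph in `𝓗`. -/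
def IsFactor {V : Type*} (𝓗 : Set (Σ n : ℕ, SimpleGraph (Fin n))) (G F : SimpleGraph V) : Prop :=
  F ≤ G ∧ ∀ C : F.ConnectedComponent, ∃ H ∈ 𝓗, Nonempty (C.toSimpleGraph ≃g H.2)

/-- The path `P_n` of order `n`. -/
def path (n : ℕ) : Σ n : ℕ, SimpleGraph (Fin n) :=
  ⟨n, SimpleGraph.pathGraph n⟩

end PathFactor

/-!
Let `S` be a maximal barrier in the sense of Gallai and Edmonds. The odd parts of `G - S` are then
factor-critical, the rest of `G - S` has a perfect matching, and Hall's condition matches `S` into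
the parts.

A deficient part, one that cannot be tiled by copies of `P_2` and `P_7`, either has one, three or
five vertices or is a windmill: a center joined to both ends of at least three disjoint edges.
Deleting the center of a windmill and one end of each of three of these edges isolates their other
ends, so that a windmill also makes the left-hand side of the component condition exceed the
right-hand side. Applied to the union of these deletions and the set `N ⊆ S` of neighbors of some
deficient parts, the condition therefore bounds the number of these parts, with singletons counted
twice, by `2|N|`. Hence, when every vertex of `S` may be used twice, each deficient part can be
matched to a vertex of `S` and each singleton to two of them. By the Mendelsohn–Dulmage theorem, one
of the two resulting matchings may be taken to saturate `S` as well.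

A deficient part left unmatched by that matching is joined by the second one to a vertex of `S`, and
so to the part matched to this vertex; if that is a singleton, one step further leads to a third
part. Each such chain contains a `P_7` whose removal leaves a set with a perfect matching.
-/

open Function

namespace PathFactor

variable {V : Type*}

theorem mem_of_reachable {F : SimpleGraph V} {A : Set V}
    (hA : ∀ x ∈ A, ∀ y, F.Adj x y → y ∈ A) {u v : V} (huv : F.Reachable u v) (hu : u ∈ A) :
    v ∈ A := by
  obtain ⟨w⟩ := huv
  induction w with
  | nil => exact hu
  | cons hadj _ ih => exact ih (hA _ hu _ hadj)

section DisjointCopies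

variable {ι : Type*} {W : ι → Type*} {K : ∀ k, SimpleGraph (W k)} {f : ∀ k, W k ↪ V}

theorem iSup_map_adj_apply_iff
    (hf : Pairwise (Disjoint on fun k => Set.range (f k))) {k : ι} {i : W k} {v : V} :
    (⨆ k, (K k).map (f k)).Adj (f k i) v ↔ ∃ j, (K k).Adj i j ∧ f k j = v := by
  simp only [SimpleGraph.iSup_adj, SimpleGraph.map_adj]
  constructor
  · rintro ⟨k', i', j, hij, hi, rfl⟩
    obtain rfl : k' = k := by
      by_contra hne
      exact Set.disjoint_left.1 (hf hne) ⟨i', rfl⟩ ⟨i, hi.symm⟩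
    exact ⟨j, (f k').injective hi ▸ hij, rfl⟩
  · rintro ⟨j, hij, rfl⟩
    exact ⟨k, i, j, hij, rfl, rfl⟩

theorem supp_connectedComponentMk_iSup_map (hK : ∀ k, (K k).Connected)
    (hf : Pairwise (Disjoint on fun k => Set.range (f k))) (k : ι) (i : W k) :
    ((⨆ k, (K k).map (f k)).connectedComponentMk (f k i)).supp = Set.range (f k) := by
  ext v
  rw [SimpleGraph.ConnectedComponent.mem_supp_iff, SimpleGraph.ConnectedComponent.eq]
  constructor
  · refine fun hv => mem_of_reachable ?_ hv.symm ⟨i, rfl⟩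
    rintro _ ⟨j, rfl⟩ y hy
    obtain ⟨j', -, rfl⟩ := (iSup_map_adj_apply_iff hf).1 hy
    exact ⟨j', rfl⟩
  · rintro ⟨j, rfl⟩
    exact ((hK k).preconnected j i).map
      ⟨f k, fun h => (iSup_map_adj_apply_iff hf).2 ⟨_, h, rfl⟩⟩

theorem nonempty_iso_component_iSup_map (hK : ∀ k, (K k).Connected)
    (hf : Pairwise (Disjoint on fun k => Set.range (f k))) (k : ι) (i : W k) :
    Nonempty (((⨆ k, (K k).map (f k)).connectedComponentMk (f k i)).toSimpleGraph ≃g K k) := by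
  let φ : K k ↪g ⨆ k, (K k).map (f k) :=
    ⟨f k, by simp [iSup_map_adj_apply_iff hf]⟩
  change Nonempty (SimpleGraph.induce (SimpleGraph.ConnectedComponent.supp _) _ ≃g K k)
  rw [supp_connectedComponentMk_iSup_map hK hf]
  exact ⟨φ.isoInduceRange.symm⟩

end DisjointCopies

/-- The set `A` can be partitioned into the vertex sets of (not necessarily induced) copies in `G`
of graphs in `𝓗`; an `𝓗`-factor is a tiling of the whole vertex set. -/
def Tileable [DecidableEq V] (𝓗 : Set (Σ n : ℕ, SimpleGraph (Fin n))) (G : SimpleGraph V)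
    (A : Finset V) : Prop :=
  ∃ P : Finpartition A, ∀ p ∈ P.parts, ∃ H ∈ 𝓗, ∃ f : SimpleGraph.Copy H.2 G, Set.range f = p

section Tilings

variable [DecidableEq V] {𝓗 : Set (Σ n : ℕ, SimpleGraph (Fin n))} {G : SimpleGraph V}

theorem Tileable.exists_isFactor [Fintype V] (h𝓗 : ∀ H ∈ 𝓗, H.2.Connected)
    (h : Tileable 𝓗 G Finset.univ) : ∃ F : SimpleGraph V, IsFactor 𝓗 G F := by
  obtain ⟨P, hP⟩ := h
  choose H hH f hf using fun p : P.parts => hP p p.2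
  have hdisj : Pairwise (Disjoint on fun p => Set.range (f p).toEmbedding) := by
    intro p q hpq
    change Disjoint (Set.range (f p)) (Set.range (f q))
    rw [hf, hf, Finset.disjoint_coe]
    exact P.disjoint p.2 q.2 (Subtype.coe_ne_coe.2 hpq)
  refine ⟨⨆ p, (H p).2.map (f p).toEmbedding, iSup_le fun p => ?_, fun C => ?_⟩
  · rintro _ _ ⟨-, i, j, hij, rfl, rfl⟩
    exact (f p).toHom.map_adj hij
  · obtain ⟨v, rfl⟩ := C.exists_rep
    obtain ⟨p, hp, hv⟩ := P.exists_mem (Finset.mem_univ v)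
    obtain ⟨i, rfl⟩ : v ∈ Set.range (f ⟨p, hp⟩) := by rwa [hf]
    exact ⟨H ⟨p, hp⟩, hH _,
      nonempty_iso_component_iSup_map (fun p => h𝓗 _ (hH p)) hdisj ⟨p, hp⟩ i⟩

theorem Tileable.empty : Tileable 𝓗 G ∅ := ⟨Finpartition.empty _, by simp⟩

theorem Tileable.biUnion {ι : Type*} {I : Finset ι} {A : ι → Finset V}
    (h : ∀ i ∈ I, Tileable 𝓗 G (A i)) (hd : (I : Set ι).PairwiseDisjoint A) :
    Tileable 𝓗 G (I.biUnion A) := by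
  choose! P hP using h
  refine ⟨(Finpartition.combine P hd.supIndep).copy (Finset.sup_eq_biUnion _ _), fun p hp => ?_⟩
  obtain ⟨i, hi, hp⟩ := Finset.mem_biUnion.1 hp
  exact hP i hi p hp

theorem Tileable.union {A B : Finset V} (hA : Tileable 𝓗 G A) (hB : Tileable 𝓗 G B)
    (hAB : Disjoint A B) : Tileable 𝓗 G (A ∪ B) := by
  have := Tileable.biUnion (I := Finset.univ) (A := fun b : Bool => cond b A B)
    (𝓗 := 𝓗) (G := G) (by simp [hA, hB])
    (by simp [Set.PairwiseDisjoint, Set.Pairwise, Function.onFun, hAB, hAB.symm])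
  simpa [Finset.biUnion_insert] using this

theorem tileable_of_isChain {n : ℕ} (hn : path n ∈ 𝓗) {l : List V} (hl : l.length = n)
    (hnd : l.Nodup) (hc : l.IsChain G.Adj) : Tileable 𝓗 G l.toFinset := by
  subst hl
  rcases eq_or_ne l [] with rfl | hl₀
  · exact Tileable.empty
  have hadj : ∀ i j : Fin l.length, (SimpleGraph.pathGraph l.length).Adj i j →
      G.Adj (l.get i) (l.get j) := by
    intro i j hij
    rw [List.isChain_iff_getElem] at hc
    rcases SimpleGraph.pathGraph_adj.1 hij with h | h
    · simpa only [List.get_eq_getElem, ← h] using hc i (by omega)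
    · simpa only [List.get_eq_getElem, ← h] using (hc j (by omega)).symm
  refine ⟨Finpartition.indiscrete (by simpa using hl₀), fun p hp => ⟨_, hn, ?_⟩⟩
  rw [Finpartition.indiscrete_parts, Finset.mem_singleton] at hp
  refine ⟨⟨⟨l.get, hadj _ _⟩, List.nodup_iff_injective_get.1 hnd⟩, ?_⟩
  ext v
  rw [hp, Finset.mem_coe, List.mem_toFinset, List.mem_iff_get]
  rfl

end Tilings

/-- A fixed-point-free involution of `A` along edges of `G`: a perfect matching of `A`, encoded by
the map sending each vertex to its partner. -/
def IsPartner (G : SimpleGraph V) (A : Finset V) (μ : V → V) : Prop :=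
  ∀ a ∈ A, μ a ∈ A ∧ μ (μ a) = a ∧ G.Adj a (μ a)

/-- The graph induced by `G` on `A` has a perfect matching. -/
def Matched (G : SimpleGraph V) (A : Finset V) : Prop :=
  ∃ μ, IsPartner G A μ

section Matchings

variable {𝓗 : Set (Σ n : ℕ, SimpleGraph (Fin n))} {G : SimpleGraph V} {A B : Finset V}

theorem IsPartner.subset {μ : V → V} (hμ : IsPartner G A μ) (hBA : B ⊆ A)
    (hB : ∀ b ∈ B, μ b ∈ B) : IsPartner G B μ :=
  fun b hb => ⟨hB b hb, (hμ b (hBA hb)).2⟩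

theorem Matched.even_card (h : Matched G A) : Even A.card := by
  obtain ⟨μ, hμ⟩ := h
  have hsum : ∑ _a ∈ A, (1 : ZMod 2) = 0 :=
    Finset.sum_involution (fun a _ => μ a) (fun _ _ => by decide)
      (fun a ha _ => (hμ a ha).2.2.ne') (fun a ha => (hμ a ha).1) (fun a ha => (hμ a ha).2.1)
  rwa [Finset.sum_const, nsmul_one, ZMod.natCast_eq_zero_iff_even] at hsum

variable [DecidableEq V]

theorem IsPartner.sdiff {μ : V → V} (hμ : IsPartner G A μ) (hB : ∀ b ∈ B, μ b ∈ B) :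
    IsPartner G (A \ B) μ := by
  refine hμ.subset Finset.sdiff_subset fun a ha => ?_
  rw [Finset.mem_sdiff] at ha ⊢
  obtain ⟨h₁, h₂, -⟩ := hμ a ha.1
  exact ⟨h₁, fun hb => ha.2 (h₂ ▸ hB _ hb)⟩

theorem matched_pair {a b : V} (h : G.Adj a b) : Matched G {a, b} := by
  refine ⟨fun x => if x = a then b else a, fun x hx => ?_⟩
  rcases Finset.mem_insert.1 hx with rfl | hx
  · simp [h.ne', h]
  · obtain rfl := Finset.mem_singleton.1 hx
    simp [h.ne', h.symm]

theorem Matched.union (hA : Matched G A) (hB : Matched G B) (hAB : Disjoint A B) :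
    Matched G (A ∪ B) := by
  obtain ⟨μ, hμ⟩ := hA
  obtain ⟨ν, hν⟩ := hB
  refine ⟨fun x => if x ∈ A then μ x else ν x, fun a ha => ?_⟩
  by_cases h : a ∈ A
  · obtain ⟨h₁, h₂, h₃⟩ := hμ a h
    simp [h, h₁, h₂, h₃]
  · obtain ⟨h₁, h₂, h₃⟩ := hν a ((Finset.mem_union.1 ha).resolve_left h)
    simp [h, h₁, h₂, h₃, Finset.disjoint_right.1 hAB h₁]

theorem Matched.tileable (h𝓗 : path 2 ∈ 𝓗) (h : Matched G A) : Tileable 𝓗 G A := by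
  obtain ⟨μ, hμ⟩ := h
  induction A using Finset.strongInduction with
  | H A ih =>
    rcases A.eq_empty_or_nonempty with rfl | ⟨a, ha⟩
    · exact Tileable.empty
    obtain ⟨h₁, h₂, h₃⟩ := hμ a ha
    have hpair : {a, μ a} ⊆ A := by simp [Finset.insert_subset_iff, ha, h₁]
    have hrest : Tileable 𝓗 G (A \ {a, μ a}) :=
      ih _ (Finset.sdiff_ssubset hpair (by simp)) (hμ.sdiff (by simp [h₂]))
    have hedge : Tileable 𝓗 G [a, μ a].toFinset :=
      tileable_of_isChain h𝓗 rfl (by simp [h₃.ne]) (by simp [h₃])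
    rw [← Finset.union_sdiff_of_subset hpair]
    exact Tileable.union (by simpa using hedge) hrest Finset.disjoint_sdiff

theorem IsPartner.mem_erase {c a : V} {μ : V → V} (hμ : IsPartner G (A.erase c) μ)
    (ha : a ∈ A) (hac : a ≠ c) :
    μ a ∈ A ∧ μ a ≠ c ∧ μ a ≠ a ∧ μ (μ a) = a ∧ G.Adj a (μ a) := by
  obtain ⟨h₁, h₂, h₃⟩ := hμ a (Finset.mem_erase.2 ⟨hac, ha⟩)
  rw [Finset.mem_erase] at h₁
  exact ⟨h₁.2, h₁.1, h₃.ne', h₂, h₃⟩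

end Matchings

/-- `A` can be partitioned into vertex sets of paths of order two and seven. -/
abbrev PathTileable [DecidableEq V] (G : SimpleGraph V) (A : Finset V) : Prop :=
  Tileable {path 2, path 7} G A

section PathTilings

variable [DecidableEq V] {G : SimpleGraph V} {A : Finset V}

theorem Matched.pathTileable (h : Matched G A) : PathTileable G A :=
  h.tileable (by simp)

theorem pathTileable_toFinset_union {l : List V} (hl : l.length = 7) (hnd : l.Nodup)
    (hc : l.IsChain G.Adj) (hA : Matched G A) (hlA : ∀ x ∈ l, x ∉ A) :
    PathTileable G (l.toFinset ∪ A) :=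
  (tileable_of_isChain (by simp) hl hnd hc).union hA.pathTileable
    (Finset.disjoint_left.2 (by simpa using hlA))

theorem IsPartner.pathTileable_of_path {c : V} {μ : V → V} (hμ : IsPartner G (A.erase c) μ)
    {l : List V} (hl : l.length = 7) (hnd : l.Nodup) (hc : l.IsChain G.Adj)
    (hlA : ∀ x ∈ l, x ∈ A) (hcl : c ∈ l) (hμl : ∀ x ∈ l, x ≠ c → μ x ∈ l) :
    PathTileable G A := by
  have hrest : Matched G (A \ l.toFinset) := by
    have h := hμ.sdiff (B := l.toFinset.erase c) fun x hx => by
      rw [Finset.mem_erase, List.mem_toFinset] at hx ⊢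
      exact ⟨(hμ.mem_erase (hlA x hx.2) hx.1).2.1, hμl x hx.2 hx.1⟩
    rw [← Finset.erase_sdiff_distrib, Finset.erase_eq_of_notMem (by simp [hcl])] at h
    exact ⟨μ, h⟩
  rw [← Finset.union_sdiff_of_subset fun x hx => hlA x (List.mem_toFinset.1 hx)]
  exact pathTileable_toFinset_union hl hnd hc hrest (by simp +contextual)

end PathTilings

/-- `T` is a union of vertex sets of components of the graph induced by `G` on `W`. -/
def IsComponentUnion (G : SimpleGraph V) (W T : Finset V) : Prop :=
  T ⊆ W ∧ ∀ a ∈ T, ∀ b ∈ W, G.Adj a b → b ∈ T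

/-- `T` is the vertex set of a component of the graph induced by `G` on `W`. -/
def IsComponent (G : SimpleGraph V) (W T : Finset V) : Prop :=
  Minimal (fun T => T.Nonempty ∧ IsComponentUnion G W T) T

section Components

variable {G : SimpleGraph V} {W W' D T U : Finset V}

theorem IsComponentUnion.refl : IsComponentUnion G W W :=
  ⟨subset_rfl, fun _ _ _ hb _ => hb⟩

theorem IsComponentUnion.mono (h : IsComponentUnion G W T) (hW : W' ⊆ W) (hT : T ⊆ W') :
    IsComponentUnion G W' T :=
  ⟨hT, fun a ha b hb => h.2 a ha b (hW hb)⟩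

theorem IsComponent.of_singleton {v : V} (h : IsComponentUnion G W {v}) :
    IsComponent G W {v} :=
  ⟨⟨Finset.singleton_nonempty v, h⟩, fun _ hT hle =>
    ((Finset.subset_singleton_iff.1 hle).resolve_left hT.1.ne_empty).ge⟩

variable [DecidableEq V]

theorem IsComponentUnion.trans (hD : IsComponentUnion G W D)
    (hT : IsComponentUnion G (D \ U) T) : IsComponentUnion G (W \ U) T := by
  refine ⟨hT.1.trans (Finset.sdiff_subset_sdiff hD.1 subset_rfl), fun a ha b hb hab => ?_⟩
  rw [Finset.mem_sdiff] at hb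
  have haD := (Finset.mem_sdiff.1 (hT.1 ha)).1
  exact hT.2 a ha b (Finset.mem_sdiff.2 ⟨hD.2 a haD b hb.1 hab, hb.2⟩) hab

theorem IsComponentUnion.trans_isComponent (hD : IsComponentUnion G W D)
    (hT : IsComponent G (D \ U) T) : IsComponent G (W \ U) T :=
  ⟨⟨hT.prop.1, hD.trans hT.prop.2⟩, fun _ hT' hle => hT.le_of_le
    ⟨hT'.1, hT'.2.mono (Finset.sdiff_subset_sdiff hD.1 subset_rfl) (hle.trans hT.prop.2.1)⟩ hle⟩

end Components

/-- A factor-critical vertex set: it is nonempty, and removing any one of its vertices leaves a set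
with a perfect matching. -/
def FactorCritical [DecidableEq V] (G : SimpleGraph V) (A : Finset V) : Prop :=
  A.Nonempty ∧ ∀ v ∈ A, Matched G (A.erase v)

namespace FactorCritical

variable [DecidableEq V] {G : SimpleGraph V} {A : Finset V}

theorem odd_card (h : FactorCritical G A) : Odd A.card := by
  obtain ⟨v, hv⟩ := h.1
  rw [← Finset.card_erase_add_one hv]
  exact (h.2 v hv).even_card.add_one

theorem eq_of_isComponentUnion (h : FactorCritical G A) {T : Finset V}
    (hT : IsComponentUnion G A T) (hne : T.Nonempty) : T = A := by
  by_contra hTA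
  obtain ⟨v, hv⟩ := hne
  obtain ⟨u, hu, huT⟩ := Finset.exists_of_ssubset (hT.1.ssubset_of_ne hTA)
  obtain ⟨μ, hμ⟩ := h.2 v (hT.1 hv)
  obtain ⟨ν, hν⟩ := h.2 u hu
  have hodd : Even (T.erase v).card := by
    refine Matched.even_card ⟨μ, hμ.subset (Finset.erase_subset_erase v hT.1) fun b hb => ?_⟩
    obtain ⟨hbv, hbT⟩ := Finset.mem_erase.1 hb
    obtain ⟨h₁, h₂, -, -, h₃⟩ := hμ.mem_erase (hT.1 hbT) hbv
    exact Finset.mem_erase.2 ⟨h₂, hT.2 b hbT _ h₁ h₃⟩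
  have heven : Even T.card := by
    refine Matched.even_card ⟨ν, hν.subset (Finset.subset_erase.2 ⟨hT.1, huT⟩) fun b hb => ?_⟩
    obtain ⟨h₁, -, -, -, h₃⟩ := hν.mem_erase (hT.1 hb) (ne_of_mem_of_not_mem hb huT)
    exact hT.2 b hb _ h₁ h₃
  rw [← Finset.card_erase_add_one hv, Nat.even_add_one] at heven
  exact heven hodd

theorem isComponent (h : FactorCritical G A) : IsComponent G A A :=
  ⟨⟨h.1, IsComponentUnion.refl⟩, fun _ hT _ => (h.eq_of_isComponentUnion hT.2 hT.1).ge⟩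

theorem exists_adj_notMem (h : FactorCritical G A) {B : Finset V} (hB : B ⊆ A)
    (hne : B.Nonempty) (hcard : B.card < A.card) : ∃ g ∈ B, ∃ p ∈ A, p ∉ B ∧ G.Adj g p := by
  by_contra! hcon
  have hBA := h.eq_of_isComponentUnion
    ⟨hB, fun a ha b hb hab => by_contra fun hbB => hcon a ha b hb hbB hab⟩ hne
  exact hcard.ne (congrArg Finset.card hBA)

theorem pathTileable_of_five_cycle (h : FactorCritical G A) (hcard : 7 ≤ A.card) {c : V}
    (hc : c ∈ A) {μ : V → V} (hμ : IsPartner G (A.erase c) μ) {x z : V} (hx : x ∈ A)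
    (hxc : x ≠ c) (hz : z ∈ A) (hzc : z ≠ c) (hzx : z ≠ x) (hzy : z ≠ μ x)
    (hcx : G.Adj c x) (hyz : G.Adj (μ x) z) (hwc : G.Adj (μ z) c) : PathTileable G A := by
  obtain ⟨x₁, x₂, x₃, x₄, x₅⟩ := hμ.mem_erase hx hxc
  obtain ⟨z₁, z₂, z₃, z₄, z₅⟩ := hμ.mem_erase hz hzc
  obtain ⟨g, hg, p, hpA, hp, hgp⟩ := h.exists_adj_notMem (B := {c, x, μ x, z, μ z})
    (by simp [Finset.insert_subset_iff, *]) (by simp)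
    (Finset.card_le_five.trans_lt (by omega))
  simp only [Finset.mem_insert, Finset.mem_singleton, not_or] at hg hp
  obtain ⟨p₁, p₂, p₃, p₄, p₅⟩ := hμ.mem_erase hpA hp.1
  -- open the five-cycle `c, x, μ x, z, μ z` at `g` and append the edge from `p` to `μ p`
  have extend : ∀ l : List V, l.Perm [c, x, μ x, z, μ z] → (l ++ [p, μ p]).IsChain G.Adj →
      PathTileable G A := by
    intro l hl hchain
    have hlen : (l ++ [p, μ p]).length = 7 := by simp [hl.length_eq]
    have hnd : l.Nodup := hl.nodup_iff.2 (by grind)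
    have hmem : ∀ v, v ∈ l ↔ v = c ∨ v = x ∨ v = μ x ∨ v = z ∨ v = μ z := by simp [hl.mem_iff]
    clear hl
    exact hμ.pathTileable_of_path hlen (by grind [List.nodup_append]) hchain
      (by grind) (by grind) (by grind)
  rcases hg with rfl | rfl | rfl | rfl | rfl
  · exact extend [x, μ x, z, μ z, g] (by grind) (by simp [*])
  · exact extend [μ g, z, μ z, c, g] (by grind) (by simp [*])
  · exact extend [z, μ z, c, x, μ x] (by grind) (by simp [*])
  · exact extend [μ g, c, x, μ x, g] (by grind) (by simp [*])
  · exact extend [c, x, μ x, z, μ z] (by grind) (by simp [*])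

theorem adj_partner (h : FactorCritical G A) (hcard : 7 ≤ A.card) (hT : ¬ PathTileable G A)
    {c x : V} (hc : c ∈ A) {μ : V → V} (hμ : IsPartner G (A.erase c) μ) (hx : x ∈ A)
    (hcx : G.Adj c x) : G.Adj c (μ x) := by
  by_contra hcon
  refine hT ?_
  have hxc : x ≠ c := hcx.ne'
  obtain ⟨x₁, x₂, x₃, x₄, x₅⟩ := hμ.mem_erase hx hxc
  -- an alternating walk from `c`: along `μ`-edges and edges of a matching `ν` that misses `x`
  obtain ⟨ν, hν⟩ := h.2 x hx
  obtain ⟨z₁, z₂, z₃, z₄, z₅⟩ := hν.mem_erase x₁ x₃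
  set z := ν (μ x)
  have hzc : z ≠ c := fun e => hcon (e ▸ z₅.symm)
  obtain ⟨w₁, w₂, w₃, w₄, w₅⟩ := hμ.mem_erase z₁ hzc
  obtain ⟨u₁, u₂, u₃, u₄, u₅⟩ := hν.mem_erase w₁ (by grind : μ z ≠ x)
  set u := ν (μ z)
  by_cases huc : u = c
  · exact h.pathTileable_of_five_cycle hcard hc hμ hx hxc z₁ hzc z₂ z₃ hcx z₅ (huc ▸ u₅)
  obtain ⟨v₁, v₂, v₃, v₄, v₅⟩ := hμ.mem_erase u₁ huc
  have huy : u ≠ μ x := by grind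
  have huz : u ≠ z := by grind
  clear_value z u
  clear hν z₄ u₄
  exact hμ.pathTileable_of_path (l := [c, x, μ x, z, μ z, u, μ u]) rfl (by grind)
    (by simp [*]) (by grind) (by grind) (by grind)

theorem exists_three_neighbors (h : FactorCritical G A) (hcard : 7 ≤ A.card)
    (hT : ¬ PathTileable G A) :
    ∃ c ∈ A, ∃ B ⊆ A, B.card = 3 ∧ ∀ b ∈ B, G.Adj c b := by
  obtain ⟨c, hc⟩ := h.1
  obtain ⟨g, hg, x, hx, -, hcx⟩ := h.exists_adj_notMem (B := {c}) (by simpa using hc) (by simp)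
    (by rw [Finset.card_singleton]; omega)
  obtain rfl := Finset.mem_singleton.1 hg
  obtain ⟨μ, hμ⟩ := h.2 g hc
  obtain ⟨y₁, y₂, y₃, -, hxy⟩ := hμ.mem_erase hx hcx.ne'
  have hcy : G.Adj g (μ x) := h.adj_partner hcard hT hc hμ hx hcx
  have hgx := hcx.ne
  -- an edge leaving the triangle gives its endpoint in the triangle a third neighbor
  obtain ⟨g', hg', p, hp, hpB, hgp⟩ := h.exists_adj_notMem (B := {g, x, μ x})
    (by simp [Finset.insert_subset_iff, *]) (by simp) (Finset.card_le_three.trans_lt (by omega))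
  simp only [Finset.mem_insert, Finset.mem_singleton, not_or] at hg' hpB
  rcases hg' with rfl | rfl | rfl
  · exact ⟨g', hc, {x, μ x, p}, by simp [Finset.insert_subset_iff, *],
      Finset.card_eq_three.2 ⟨_, _, _, by grind, by grind, by grind, rfl⟩, by simp [*]⟩
  · exact ⟨g', hx, {g, μ g', p}, by simp [Finset.insert_subset_iff, *],
      Finset.card_eq_three.2 ⟨_, _, _, by grind, by grind, by grind, rfl⟩, by simp [*, hcx.symm]⟩
  · exact ⟨μ x, y₁, {g, x, p}, by simp [Finset.insert_subset_iff, *],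
      Finset.card_eq_three.2 ⟨_, _, _, by grind, by grind, by grind, rfl⟩,
      by simp [*, hcy.symm, hxy.symm]⟩

theorem not_adj_of_adj_center (h : FactorCritical G A) (hcard : 7 ≤ A.card)
    (hT : ¬ PathTileable G A) {c d g x : V} (hc : c ∈ A) {μ : V → V}
    (hμ : IsPartner G (A.erase c) μ) (hd : d ∈ A) (hcd : G.Adj c d) (hg : g ∈ A)
    (hcg : G.Adj c g) (hgd : g ≠ d) (hgd' : g ≠ μ d) (hx : x ∈ A) (hxc : x ≠ c) (hxd : x ≠ d)
    (hxd' : x ≠ μ d) (hxg : x ≠ μ g) : ¬ G.Adj g x := by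
  intro hgx
  have hcd' := h.adj_partner hcard hT hc hμ hd hcd
  have hcg' := h.adj_partner hcard hT hc hμ hg hcg
  obtain ⟨d₁, d₂, d₃, d₄, d₅⟩ := hμ.mem_erase hd hcd.ne'
  obtain ⟨g₁, g₂, g₃, g₄, g₅⟩ := hμ.mem_erase hg hcg.ne'
  obtain ⟨x₁, x₂, x₃, x₄, x₅⟩ := hμ.mem_erase hx hxc
  have hgx_ne := hgx.ne
  have hcd_ne := hcd.ne
  have hcg_ne := hcg.ne
  exact hT <| hμ.pathTileable_of_path (l := [d, μ d, c, μ g, g, x, μ x]) rfl (by grind)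
    (by simp [*, hcd'.symm, g₅.symm]) (by grind) (by grind) (by grind)

theorem adj_center (h : FactorCritical G A) (hcard : 7 ≤ A.card) (hT : ¬ PathTileable G A)
    {c : V} (hc : c ∈ A) {μ : V → V} (hμ : IsPartner G (A.erase c) μ) {B : Finset V}
    (hBA : B ⊆ A) (hB : B.card = 3) (hcB : ∀ b ∈ B, G.Adj c b) {x : V} (hx : x ∈ A)
    (hxc : x ≠ c) : G.Adj c x := by
  classical
  have hpartner {y : V} (hy : y ∈ A) (hcy : G.Adj c y) : G.Adj c (μ y) :=
    h.adj_partner hcard hT hc hμ hy hcy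
  have hclosed : IsComponentUnion G A (A.filter fun y => y = c ∨ G.Adj c y) := by
    refine ⟨Finset.filter_subset _ _, fun g hg y hy hgy => ?_⟩
    obtain ⟨hgA, hg⟩ := Finset.mem_filter.1 hg
    refine Finset.mem_filter.2 ⟨hy, or_iff_not_imp_left.2 fun hyc => ?_⟩
    obtain rfl | hcg := hg
    · exact hgy
    by_contra hcy
    obtain ⟨d, hdB, hd⟩ : ∃ d ∈ B, d ∉ ({g, μ g} : Finset V) :=
      Finset.exists_mem_notMem_of_card_lt_card (Finset.card_le_two.trans_lt (by omega))
    simp only [Finset.mem_insert, Finset.mem_singleton, not_or] at hd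
    have hdA := hBA hdB
    have hcd := hcB d hdB
    have hcd' := hpartner hdA hcd
    have hcg' := hpartner hgA hcg
    have hμd := (hμ.mem_erase hdA hcd.ne').2.2.2.1
    exact h.not_adj_of_adj_center hcard hT hc hμ hdA hcd hgA hcg (Ne.symm hd.1) (by grind) hy
      hyc (by grind) (by grind) (by grind) hgy
  have hall := h.eq_of_isComponentUnion hclosed ⟨c, by simp [hc]⟩
  rw [← hall] at hx
  exact (Finset.mem_filter.1 hx).2.resolve_left hxc

theorem exists_windmill (h : FactorCritical G A) (hcard : 7 ≤ A.card)
    (hT : ¬ PathTileable G A) : ∃ c ∈ A, ∃ μ : V → V, IsPartner G (A.erase c) μ ∧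
      ∀ x ∈ A, x ≠ c → ∀ y ∈ A, y ≠ c → G.Adj x y → y = μ x := by
  obtain ⟨c, hc, B, hBA, hB, hcB⟩ := h.exists_three_neighbors hcard hT
  obtain ⟨μ, hμ⟩ := h.2 c hc
  have hcenter {x : V} (hx : x ∈ A) (hxc : x ≠ c) : G.Adj c x :=
    h.adj_center hcard hT hc hμ hBA hB hcB hx hxc
  refine ⟨c, hc, μ, hμ, fun x hx hxc y hy hyc hxy => ?_⟩
  by_contra hne
  obtain ⟨d, hd, hdB⟩ : ∃ d ∈ A, d ∉ ({c, x, μ x, y, μ y} : Finset V) :=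
    Finset.exists_mem_notMem_of_card_lt_card (Finset.card_le_five.trans_lt (by omega))
  simp only [Finset.mem_insert, Finset.mem_singleton, not_or] at hdB
  obtain ⟨d₁, d₂, d₃, d₄, d₅⟩ := hdB
  have hμd := (hμ.mem_erase hd d₁).2.2.2.1
  exact h.not_adj_of_adj_center hcard hT hc hμ hd (hcenter hd d₁) hx (hcenter hx hxc)
    (Ne.symm d₂) (by grind) hy hyc (Ne.symm d₄) (by grind) hne hxy

end FactorCritical

/-- Three times the contribution of a component `T` to the left-hand side of the component
condition. -/
def weight (T : Finset V) : ℕ :=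
  if T.card = 1 then 3 else if T.card = 3 ∨ T.card = 5 then 1 else 0

/-- The number of vertices of the barrier that have to be available for a deficient part `T`: a
singleton becomes the end of one path and an interior vertex of another. -/
def demand (T : Finset V) : ℕ :=
  if T.card = 1 then 2 else 1

section Heavy

variable [DecidableEq V] {G : SimpleGraph V} {A : Finset V}

/-- `A` contains components of `A \ U`, for some `U ⊆ A`, whose total weight exceeds the
bound `2 * U.card` of the component condition by the demand of `A`. -/
def Heavy (G : SimpleGraph V) (A : Finset V) : Prop :=
  ∃ U ⊆ A, ∃ 𝒞 : Finset (Finset V), (∀ T ∈ 𝒞, IsComponent G (A \ U) T) ∧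
    demand A + 2 * U.card ≤ ∑ T ∈ 𝒞, weight T

theorem FactorCritical.heavy_of_card_lt (h : FactorCritical G A) (hcard : A.card < 7) :
    Heavy G A := by
  refine ⟨∅, by simp, {A}, by simpa using h.isComponent, ?_⟩
  have hodd := h.odd_card
  have hA : A.card = 1 ∨ A.card = 3 ∨ A.card = 5 := by grind
  rcases hA with e | e | e <;> simp [weight, demand, e]

theorem FactorCritical.heavy_of_not_pathTileable (h : FactorCritical G A) (hcard : 7 ≤ A.card)
    (hT : ¬ PathTileable G A) : Heavy G A := by
  obtain ⟨c, hc, μ, hμ, hadj⟩ := h.exists_windmill hcard hT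
  have pick (B : Finset V) (hB : B.card ≤ 5) : ∃ d ∈ A, d ∉ B :=
    Finset.exists_mem_notMem_of_card_lt_card (by omega)
  -- deleting the center and one vertex of each of three triangles isolates the three partners
  obtain ⟨x, hx, hx'⟩ := pick {c} (by simp)
  obtain ⟨y, hy, hy'⟩ := pick {c, x, μ x} (Finset.card_le_three.trans (by omega))
  obtain ⟨z, hz, hz'⟩ := pick {c, x, μ x, y, μ y} Finset.card_le_five
  simp only [Finset.mem_insert, Finset.mem_singleton, not_or] at hx' hy' hz'
  have hμx := hμ.mem_erase hx hx'
  have hμy := hμ.mem_erase hy hy'.1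
  have hμz := hμ.mem_erase hz hz'.1
  have isolated {v : V} (hv : v ∈ ({μ x, μ y, μ z} : Finset V)) :
      IsComponent G (A \ {c, x, y, z}) {v} := by
    refine IsComponent.of_singleton ⟨by grind, fun a ha b hb hab => ?_⟩
    obtain rfl := Finset.mem_singleton.1 ha
    have := hadj a (by grind) (by grind) b (by grind) (by grind) hab
    grind
  refine ⟨{c, x, y, z}, by simp [Finset.insert_subset_iff, *],
    ({μ x, μ y, μ z} : Finset V).image singleton, fun T hT' => ?_, ?_⟩
  · obtain ⟨v, hv, rfl⟩ := Finset.mem_image.1 hT'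
    exact isolated hv
  · have hthree : ({μ x, μ y, μ z} : Finset V).card = 3 :=
      Finset.card_eq_three.2 ⟨_, _, _, by grind, by grind, by grind, rfl⟩
    have hU : ({c, x, y, z} : Finset V).card ≤ 4 := Finset.card_le_four
    have hsum : ∑ T ∈ ({μ x, μ y, μ z} : Finset V).image singleton, weight T = 9 := by
      rw [Finset.sum_image (Finset.singleton_injective.injOn)]
      simp [weight, hthree]
    rw [hsum, demand, if_neg (by omega)]
    omega

end Heavy

section ComponentSets

variable {W : Type*} {G : SimpleGraph V} {K : SimpleGraph W} (e : K ↪g G) {A T : Finset V}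

theorem isComponentUnion_of_coe_eq_image_supp (hA : (A : Set V) = Set.range e)
    {C : K.ConnectedComponent} (hT : (T : Set V) = e '' C.supp) : IsComponentUnion G A T := by
  refine ⟨Finset.coe_subset.1 (hT ▸ hA ▸ Set.image_subset_range e C.supp), fun a ha b hb hab => ?_⟩
  rw [← Finset.mem_coe, hT] at ha ⊢
  rw [← Finset.mem_coe, hA] at hb
  obtain ⟨v, hv, rfl⟩ := ha
  obtain ⟨w, rfl⟩ := hb
  exact ⟨w, C.mem_supp_of_adj_mem_supp hv (e.map_adj_iff.1 hab), rfl⟩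

theorem IsComponent.exists_coe_eq_image_supp (h : IsComponent G A T)
    (hA : (A : Set V) = Set.range e) : ∃ C : K.ConnectedComponent, (T : Set V) = e '' C.supp := by
  classical
  obtain ⟨⟨a, ha⟩, hTA, hclosed⟩ := h.prop
  have hmem (w : W) : e w ∈ A := by simp [← Finset.mem_coe, hA]
  obtain ⟨v, rfl⟩ : a ∈ Set.range e := hA ▸ Finset.mem_coe.2 (hTA ha)
  let C := K.connectedComponentMk v
  have hCT : e '' C.supp ⊆ T := by
    rintro _ ⟨w, hw, rfl⟩
    exact mem_of_reachable (A := e ⁻¹' T)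
      (fun x hx y hxy => hclosed _ hx _ (hmem y) (e.map_adj_iff.2 hxy))
      (SimpleGraph.ConnectedComponent.exact hw).symm ha
  refine ⟨C, (Set.Subset.antisymm hCT fun x hx => ?_).symm⟩
  have hcoe : (T.filter (· ∈ e '' C.supp) : Set V) = e '' C.supp := by
    rw [Finset.coe_filter]
    exact Set.inter_eq_right.2 hCT
  have hle := h.le_of_le ⟨⟨e v, Finset.mem_filter.2 ⟨ha, v, rfl, rfl⟩⟩,
    isComponentUnion_of_coe_eq_image_supp e hA hcoe⟩ (Finset.filter_subset _ T)
  exact (Finset.mem_filter.1 (hle hx)).2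

end ComponentSets

/-- A family of disjoint odd sets, each a union of components of the graph induced by `G` on `W`. -/
def OddParts (G : SimpleGraph V) (W : Finset V) (𝒯 : Finset (Finset V)) : Prop :=
  (∀ T ∈ 𝒯, IsComponentUnion G W T ∧ Odd T.card) ∧ (𝒯 : Set (Finset V)).PairwiseDisjoint id

section Tutte

variable {G : SimpleGraph V} {A B : Finset V}

theorem exists_oddParts_card_eq_ncard_oddComponents {W : Type*} [Finite W] {K : SimpleGraph W}
    (e : K ↪g G) (hA : (A : Set V) = Set.range e) :
    ∃ 𝒪, OddParts G A 𝒪 ∧ 𝒪.card = K.oddComponents.ncard := by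
  classical
  let t (C : K.ConnectedComponent) : Finset V := (Set.toFinite (e '' C.supp)).toFinset
  have ht (C : K.ConnectedComponent) : (t C : Set V) = e '' C.supp := Set.Finite.coe_toFinset _
  have hdisj {C D : K.ConnectedComponent} (hCD : C ≠ D) : Disjoint (t C) (t D) := by
    rw [← Finset.disjoint_coe, ht, ht, Set.disjoint_image_iff e.injective]
    exact SimpleGraph.pairwise_disjoint_supp_connectedComponent K hCD
  have hcard (C : K.ConnectedComponent) : (t C).card = C.supp.ncard := by
    rw [← Set.ncard_coe_finset, ht, Set.ncard_image_of_injective _ e.injective]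
  have hinj : Injective t := fun C D hCD => by
    by_contra hne
    have hempty := hdisj hne
    rw [hCD, disjoint_self, Finset.bot_eq_empty, ← Finset.coe_eq_empty, ht, Set.image_eq_empty]
      at hempty
    exact D.nonempty_supp.ne_empty hempty
  refine ⟨(Set.toFinite K.oddComponents).toFinset.image t, ⟨?_, ?_⟩, ?_⟩
  · simp only [Finset.forall_mem_image, Set.Finite.mem_toFinset]
    exact fun C hC => ⟨isComponentUnion_of_coe_eq_image_supp e hA (ht C), (hcard C).symm ▸ hC⟩
  · rw [Finset.coe_image]
    rintro _ ⟨C, -, rfl⟩ _ ⟨D, -, rfl⟩ hne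
    exact hdisj (ne_of_apply_ne t hne)
  · rw [Finset.card_image_of_injective _ hinj, Set.ncard_eq_toFinset_card]

theorem matched_of_isPerfectMatching {M : (G.induce (B : Set V)).Subgraph}
    (hM : M.IsPerfectMatching) : Matched G B := by
  classical
  rw [SimpleGraph.Subgraph.isPerfectMatching_iff] at hM
  choose f hf huniq using hM
  refine ⟨fun v => if h : v ∈ B then f ⟨v, h⟩ else v, fun a ha => ?_⟩
  have hadj := hf ⟨a, ha⟩
  have hinv : f (f ⟨a, ha⟩) = ⟨a, ha⟩ := (huniq _ _ hadj.symm).symm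
  have hG : G.Adj a (f ⟨a, ha⟩) := hadj.adj_sub
  have hfB : (f ⟨a, ha⟩ : V) ∈ B := (f ⟨a, ha⟩).2
  simp [ha, hinv, hG, hfB]

theorem ncard_add_two_le_of_isTutteViolator [Finite V] (heven : Even (Nat.card V)) {u : Set V}
    (hu : G.IsTutteViolator u) :
    u.ncard + 2 ≤ ((⊤ : G.Subgraph).deleteVerts u).coe.oddComponents.ncard := by
  have hlt : u.ncard < _ := hu
  have hodd := ((⊤ : G.Subgraph).deleteVerts u).coe.odd_ncard_oddComponents
  have hcard : Nat.card ((⊤ : G.Subgraph).deleteVerts u).verts = Nat.card V - u.ncard := by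
    rw [Nat.card_coe_set_eq, ← Set.ncard_compl, Set.compl_eq_univ_sdiff]
    rfl
  rw [hcard, Nat.odd_sub (Set.ncard_le_card u)] at hodd
  grind

theorem exists_oddParts_of_not_matched [DecidableEq V] (hB : ¬ Matched G B)
    (heven : Even B.card) : ∃ U ⊆ B, ∃ 𝒪, OddParts G (B \ U) 𝒪 ∧ U.card + 2 ≤ 𝒪.card := by
  obtain ⟨u, hu⟩ := SimpleGraph.exists_isTutteViolator
    (G := G.induce (B : Set V)) (fun M hM => hB (matched_of_isPerfectMatching hM)) (by simpa)
  set K := (⊤ : (G.induce (B : Set V)).Subgraph).deleteVerts u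
  have hK (w : (B : Set V)) : w ∈ K.verts ↔ w ∉ u := by simp [K]
  let e : K.coe ↪g G := ⟨⟨fun w => w.1.1, Subtype.val_injective.comp Subtype.val_injective⟩,
    fun {v w} => by simp [K, (hK _).1 v.2, (hK _).1 w.2]⟩
  obtain ⟨U, hU⟩ := (Set.toFinite (Subtype.val '' u)).exists_finset_coe
  have hUB : U ⊆ B := by
    rw [← Finset.coe_subset, hU]
    exact Subtype.coe_image_subset _ u
  have hrange : ((B \ U : Finset V) : Set V) = Set.range e := by
    ext v
    simp only [e, K, Finset.mem_coe, Finset.mem_sdiff, ← Finset.mem_coe (s := U), hU]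
    simp only [Set.mem_image, Subtype.exists, exists_and_right, exists_eq_right, not_exists,
      RelEmbedding.coe_mk, Embedding.coeFn_mk, Set.mem_range, SimpleGraph.Subgraph.induce_verts,
      SimpleGraph.Subgraph.verts_top, Set.mem_sdiff, Set.mem_univ, true_and, exists_prop,
      SetLike.coe_sort_coe]
    tauto
  obtain ⟨𝒪, h𝒪, hcard⟩ := exists_oddParts_card_eq_ncard_oddComponents e hrange
  refine ⟨U, hUB, 𝒪, h𝒪, ?_⟩
  rw [hcard, ← Set.ncard_coe_finset, hU, Set.ncard_image_of_injective u Subtype.val_injective]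
  exact ncard_add_two_le_of_isTutteViolator (by simpa using heven) hu

end Tutte

section Barrier

variable [DecidableEq V] {G : SimpleGraph V} {W D U : Finset V} {𝒯 𝒪 : Finset (Finset V)}

theorem OddParts.isComponentUnion_sdiff (h : OddParts G W 𝒯) :
    IsComponentUnion G W (W \ 𝒯.biUnion id) := by
  refine ⟨Finset.sdiff_subset, fun a ha b hb hab => Finset.mem_sdiff.2 ⟨hb, fun hb' => ?_⟩⟩
  obtain ⟨haW, ha⟩ := Finset.mem_sdiff.1 ha
  obtain ⟨T, hT, hbT⟩ := Finset.mem_biUnion.1 hb'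
  exact ha (Finset.mem_biUnion.2 ⟨T, hT, (h.1 T hT).1.2 b hbT a haW hab.symm⟩)

theorem OddParts.union (h : OddParts G W 𝒯) (hD : IsComponentUnion G W D)
    (hDT : ∀ T ∈ 𝒯, Disjoint D T) (hU : U ⊆ D) (h' : OddParts G (D \ U) 𝒪) :
    OddParts G (W \ U) (𝒯 ∪ 𝒪) := by
  refine ⟨fun T hT => ?_, ?_⟩
  · obtain hT | hT := Finset.mem_union.1 hT
    · refine ⟨(h.1 T hT).1.mono Finset.sdiff_subset ?_, (h.1 T hT).2⟩
      exact Finset.subset_sdiff.2 ⟨(h.1 T hT).1.1, ((hDT T hT).mono_left hU).symm⟩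
    · exact ⟨hD.trans (h'.1 T hT).1, (h'.1 T hT).2⟩
  · rw [Finset.coe_union, Set.pairwiseDisjoint_union]
    exact ⟨h.2, h'.2, fun T hT T' hT' _ =>
      ((hDT T hT).mono_left ((h'.1 T' hT').1.1.trans Finset.sdiff_subset)).symm⟩

theorem OddParts.card_union (hDT : ∀ T ∈ 𝒯, Disjoint D T) (h' : OddParts G (D \ U) 𝒪) :
    (𝒯 ∪ 𝒪).card = 𝒯.card + 𝒪.card := by
  refine Finset.card_union_of_disjoint (Finset.disjoint_left.2 fun T hT hT' => ?_)
  obtain ⟨hTD, hodd⟩ := h'.1 T hT'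
  have hempty := (hDT T hT).mono_left (hTD.1.trans Finset.sdiff_subset)
  rw [disjoint_self, Finset.bot_eq_empty, ← Finset.card_eq_zero] at hempty
  exact hodd.pos.ne' hempty

/-- Some vertex of `A` is adjacent to `s`. -/
def Touches (G : SimpleGraph V) (s : V) (A : Finset V) : Prop :=
  ∃ t ∈ A, G.Adj s t

/-- `S` is a maximal barrier of `G` in the sense of Gallai and Edmonds: the difference between the
number of odd parts in `𝒯` and the size of `S` is as large as possible and, subject to this, `S` is
as large as possible. -/
structure IsMaximalBarrier [Fintype V] (G : SimpleGraph V) (S : Finset V)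
    (𝒯 : Finset (Finset V)) : Prop where
  oddParts : OddParts G Sᶜ 𝒯
  card_le {S' : Finset V} {𝒯' : Finset (Finset V)} (h : OddParts G S'ᶜ 𝒯') :
    𝒯'.card + S.card ≤ 𝒯.card + S'.card
  card_le_of_le {S' : Finset V} {𝒯' : Finset (Finset V)} (h : OddParts G S'ᶜ 𝒯')
    (hle : 𝒯.card + S'.card ≤ 𝒯'.card + S.card) : S'.card ≤ S.card

variable [Fintype V] {S : Finset V}

theorem exists_isMaximalBarrier (G : SimpleGraph V) : ∃ S 𝒯, IsMaximalBarrier G S 𝒯 := by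
  classical
  obtain ⟨⟨S, 𝒯⟩, hmem, hmax⟩ := Finset.exists_max_image
    (Finset.univ.filter fun p : Finset V × Finset (Finset V) => OddParts G p.1ᶜ p.2)
    (fun p => toLex ((p.2.card : ℤ) - p.1.card, p.1.card)) ⟨(∅, ∅),
      Finset.mem_filter.2 ⟨Finset.mem_univ _, by simp [OddParts]⟩⟩
  have hopt {S' 𝒯'} (h : OddParts G S'ᶜ 𝒯') : (𝒯'.card : ℤ) - S'.card < 𝒯.card - S.card ∨
      (𝒯'.card : ℤ) - S'.card = 𝒯.card - S.card ∧ S'.card ≤ S.card := by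
    simpa only [Prod.Lex.toLex_le_toLex] using hmax (S', 𝒯') (by simpa using h)
  refine ⟨S, 𝒯, (Finset.mem_filter.1 hmem).2, fun h => ?_, fun h hle => ?_⟩
  all_goals
    have := hopt h
    omega

namespace IsMaximalBarrier

theorem factorCritical (h : IsMaximalBarrier G S 𝒯) {C : Finset V} (hC : C ∈ 𝒯) :
    FactorCritical G C := by
  obtain ⟨hCS, hodd⟩ := h.oddParts.1 C hC
  refine ⟨Finset.card_pos.1 hodd.pos, fun v hv => ?_⟩
  by_contra hM
  obtain ⟨U, hU, 𝒪, h𝒪, hlt⟩ := exists_oddParts_of_not_matched hM (by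
    rw [Finset.card_erase_of_mem hv]
    exact hodd.tsub_odd odd_one)
  have hU' : insert v U ⊆ C := Finset.insert_subset hv (hU.trans (Finset.erase_subset v C))
  have hvU : v ∉ U := fun hvU => Finset.notMem_erase v C (hU hvU)
  rw [Finset.erase_eq, sdiff_sdiff_left, Finset.sup_eq_union, ← Finset.insert_eq] at h𝒪
  have hdisj : ∀ T ∈ 𝒯.erase C, Disjoint C T := fun T hT =>
    h.oddParts.2 hC (Finset.mem_of_mem_erase hT) (Finset.ne_of_mem_erase hT).symm
  have herase : OddParts G Sᶜ (𝒯.erase C) :=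
    ⟨fun T hT => h.oddParts.1 T (Finset.mem_of_mem_erase hT),
      h.oddParts.2.subset (Finset.coe_subset.2 (Finset.erase_subset C 𝒯))⟩
  have hnew : OddParts G (S ∪ insert v U)ᶜ (𝒯.erase C ∪ 𝒪) := by
    rw [Finset.compl_union, ← Finset.sdiff_eq_inter_compl]
    exact herase.union hCS hdisj hU' h𝒪
  have hSU : (S ∪ insert v U).card = S.card + (U.card + 1) := by
    rw [Finset.card_union_of_disjoint, Finset.card_insert_of_notMem hvU]
    exact Finset.disjoint_left.2 fun x hx hxU => Finset.mem_compl.1 (hCS.1 (hU' hxU)) hx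
  have hcard := Finset.card_erase_add_one hC
  have hunion := OddParts.card_union hdisj h𝒪
  have := h.card_le_of_le hnew (by omega)
  omega

theorem matched_rest (h : IsMaximalBarrier G S 𝒯) : Matched G (Sᶜ \ 𝒯.biUnion id) := by
  set R := Sᶜ \ 𝒯.biUnion id
  have hR := h.oddParts.isComponentUnion_sdiff
  have hdisj : ∀ T ∈ 𝒯, Disjoint R T := fun T hT =>
    Finset.disjoint_sdiff.symm.mono_right (Finset.subset_biUnion_of_mem id hT)
  have bound {U 𝒪} (hU : U ⊆ R) (h𝒪 : OddParts G (R \ U) 𝒪) : 𝒪.card ≤ U.card := by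
    have hnew : OddParts G (S ∪ U)ᶜ (𝒯 ∪ 𝒪) := by
      rw [Finset.compl_union, ← Finset.sdiff_eq_inter_compl]
      exact h.oddParts.union hR hdisj hU h𝒪
    have := h.card_le hnew
    have := OddParts.card_union hdisj h𝒪
    have := Finset.card_union_le S U
    omega
  have heven : Even R.card := by
    by_contra hodd
    have hone : OddParts G (R \ ∅) {R} := by
      simpa [OddParts] using ⟨IsComponentUnion.refl, Nat.not_even_iff_odd.1 hodd⟩
    simpa using bound (Finset.empty_subset R) hone
  by_contra hM
  obtain ⟨U, hU, 𝒪, h𝒪, hlt⟩ := exists_oddParts_of_not_matched hM heven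
  have := bound hU h𝒪
  omega

open Classical in
theorem card_le_card_touches (h : IsMaximalBarrier G S 𝒯) {A : Finset V} (hA : A ⊆ S) :
    A.card ≤ (𝒯.filter fun T => ∃ a ∈ A, Touches G a T).card := by
  have hnew : OddParts G (S \ A)ᶜ (𝒯.filter fun T => ¬ ∃ a ∈ A, Touches G a T) := by
    refine ⟨fun T hT => ?_, h.oddParts.2.subset (Finset.coe_subset.2 (Finset.filter_subset _ _))⟩
    obtain ⟨hT, hTA⟩ := Finset.mem_filter.1 hT
    obtain ⟨⟨hTS, hclosed⟩, hodd⟩ := h.oddParts.1 T hT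
    refine ⟨⟨hTS.trans (Finset.compl_subset_compl.2 Finset.sdiff_subset),
      fun a ha b hb hab => ?_⟩, hodd⟩
    have hbA : b ∉ A := fun hbA => hTA ⟨b, hbA, a, ha, hab.symm⟩
    exact hclosed a ha b (by simpa [hbA] using hb) hab
  have hsplit := Finset.card_filter_add_card_filter_not (s := 𝒯) (fun T => ∃ a ∈ A, Touches G a T)
  have hcard := Finset.card_sdiff_add_card_eq_card hA
  have := h.card_le hnew
  omega

end IsMaximalBarrier

end Barrier

section BipartiteMatchings

variable {α β : Type*}

/-- The Mendelsohn–Dulmage theorem. -/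
theorem exists_injective_subset_range {R : α → β → Prop} {f : α → β} (hf : Injective f)
    (hfR : ∀ a, R a (f a)) {D : Set β} {g : D → α} (hg : Injective g) (hgR : ∀ b, R (g b) b) :
    ∃ m : α → β, Injective m ∧ (∀ a, R a (m a)) ∧ D ⊆ Set.range m := by
  classical
  let F : Set α →o Set α := ⟨fun X => {a | ∃ b, g b = a ∧ ∀ a', f a' = b → a' ∈ X},
    fun X Y hXY a ⟨b, hb, hbX⟩ => ⟨b, hb, fun x hx => hXY (hbX x hx)⟩⟩
  -- on a fixed point `Z` of `F` use `g`, and outside of it use `f`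
  let Z := F.lfp
  have hZ (a : α) : a ∈ Z ↔ ∃ b, g b = a ∧ ∀ a', f a' = b → a' ∈ Z :=
    Set.ext_iff.1 F.map_lfp.symm a
  choose k hkg hkf using fun a : Z => (hZ a).1 a.2
  have hm (a : α) : ∃ b : β, (∀ ha : a ∈ Z, b = k ⟨a, ha⟩) ∧ (a ∉ Z → b = f a) := by
    by_cases ha : a ∈ Z
    · exact ⟨k ⟨a, ha⟩, fun _ => rfl, fun h => absurd ha h⟩
    · exact ⟨f a, fun h => absurd h ha, fun _ => rfl⟩
  choose m hmk hmf using hm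
  refine ⟨m, fun a a' h => ?_, fun a => ?_, fun b hb => ?_⟩
  · by_cases ha : a ∈ Z <;> by_cases ha' : a' ∈ Z
    · rw [hmk a ha, hmk a' ha'] at h
      exact (hkg ⟨a, ha⟩).symm.trans ((congrArg g (Subtype.ext h)).trans (hkg ⟨a', ha'⟩))
    · rw [hmk a ha, hmf a' ha'] at h
      exact absurd (hkf ⟨a, ha⟩ a' h.symm) ha'
    · rw [hmf a ha, hmk a' ha'] at h
      exact absurd (hkf ⟨a', ha'⟩ a h) ha
    · rw [hmf a ha, hmf a' ha'] at h
      exact hf h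
  · by_cases ha : a ∈ Z
    · simpa only [hmk a ha, hkg] using hgR (k ⟨a, ha⟩)
    · simpa only [hmf a ha] using hfR a
  · by_cases hgb : g ⟨b, hb⟩ ∈ Z
    · exact ⟨g ⟨b, hb⟩, (hmk _ hgb).trans (congrArg Subtype.val (hg (hkg ⟨_, hgb⟩)))⟩
    · rw [hZ] at hgb
      push Not at hgb
      obtain ⟨a, hab, ha⟩ := hgb _ rfl
      exact ⟨a, (hmf a ha).trans hab⟩

variable [DecidableEq α]

section Slots

variable {κ β₁ β₂ : Type*} [Fintype κ] [DecidableEq κ] {t₁ : β₁ → Finset α} {t₂ : β₂ → Finset α}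

/-- Each vertex of `α` has one slot of every color in `κ`. A vertex of `β₁` asks for one slot of
every color, hence splits into units indexed by `κ`; a vertex of `β₂` asks for one arbitrary
slot. -/
def slots (t₁ : β₁ → Finset α) (t₂ : β₂ → Finset α) : β₁ × κ ⊕ β₂ → Finset (α × κ) :=
  Sum.elim (fun u => t₁ u.1 ×ˢ {u.2}) fun b => t₂ b ×ˢ Finset.univ

theorem card_le_card_biUnion_slots [Nonempty κ]
    (hdem : ∀ (A₁ : Finset β₁) (A₂ : Finset β₂), Fintype.card κ * A₁.card + A₂.card ≤
      Fintype.card κ * (A₁.biUnion t₁ ∪ A₂.biUnion t₂).card) (A : Finset (β₁ × κ ⊕ β₂)) :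
    A.card ≤ (A.biUnion (slots t₁ t₂)).card := by
  classical
  let X (c : κ) : Finset β₁ := (A.toLeft.filter (·.2 = c)).image Prod.fst
  let N (c : κ) : Finset α := (X c).biUnion t₁ ∪ A.toRight.biUnion t₂
  have hX (c : κ) : (X c).card = (A.toLeft.filter (·.2 = c)).card :=
    Finset.card_image_of_injOn fun u hu v hv huv => Prod.ext huv
      ((Finset.mem_filter.1 hu).2.trans (Finset.mem_filter.1 hv).2.symm)
  have hN (c : κ) : (N c).card ≤ ((A.biUnion (slots t₁ t₂)).filter (·.2 = c)).card := by
    refine Finset.card_le_card_of_injOn (·, c) (fun a ha => ?_) fun _ _ _ _ h => congrArg Prod.fst h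
    refine Finset.mem_coe.2 (Finset.mem_filter.2 ⟨Finset.mem_biUnion.2 ?_, rfl⟩)
    obtain ha | ha := Finset.mem_union.1 ha <;> obtain ⟨b, hb, hab⟩ := Finset.mem_biUnion.1 ha
    · exact ⟨Sum.inl (b, c), by simpa [X] using hb, by simpa [slots] using hab⟩
    · exact ⟨Sum.inr b, by simpa using hb, by simpa [slots] using hab⟩
  refine Nat.le_of_mul_le_mul_left ?_ (Fintype.card_pos (α := κ))
  calc Fintype.card κ * A.card = ∑ c, (Fintype.card κ * (X c).card + A.toRight.card) := by
        rw [Finset.sum_add_distrib, ← Finset.mul_sum, ← Finset.card_toLeft_add_card_toRight,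
          Finset.card_eq_sum_card_fiberwise (s := A.toLeft) (f := Prod.snd) (t := Finset.univ)
            (fun _ _ => Finset.mem_univ _), mul_add]
        simp [hX]
    _ ≤ ∑ c, Fintype.card κ * ((A.biUnion (slots t₁ t₂)).filter (·.2 = c)).card :=
        Finset.sum_le_sum fun c _ => (hdem (X c) A.toRight).trans (Nat.mul_le_mul_left _ (hN c))
    _ = Fintype.card κ * (A.biUnion (slots t₁ t₂)).card := by
        rw [← Finset.mul_sum, ← Finset.card_eq_sum_card_fiberwise fun _ _ => Finset.mem_univ _]

end Slots

theorem two_mul_card_add_card_le {t : β → Finset α} {B : Finset β} {p : β → Prop}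
    [DecidablePred p] (hdem : ∀ A ⊆ B, ∑ b ∈ A, (if p b then 2 else 1) ≤ 2 * (A.biUnion t).card)
    (A₁ : Finset {b // b ∈ B ∧ p b}) (A₂ : Finset {b // b ∈ B ∧ ¬ p b}) :
    2 * A₁.card + A₂.card ≤
      2 * ((A₁.biUnion fun b => t b) ∪ A₂.biUnion fun b => t b).card := by
  classical
  have hdisj : Disjoint (A₁.map (.subtype _)) (A₂.map (.subtype _)) := by
    simp only [Finset.disjoint_left, Finset.mem_map]
    rintro _ ⟨b, -, rfl⟩ ⟨b', -, hb' : (b' : β) = b⟩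
    exact b'.2.2 (hb' ▸ b.2.2)
  have hsub : A₁.map (.subtype _) ∪ A₂.map (.subtype _) ⊆ B := fun b hb => by
    obtain hb | hb := Finset.mem_union.1 hb <;> obtain ⟨b, -, rfl⟩ := Finset.mem_map.1 hb
    exacts [b.2.1, b.2.1]
  have hA₁ : ∑ b ∈ A₁.map (.subtype _), (if p b then 2 else 1) = 2 * A₁.card := by
    rw [Finset.sum_map, mul_comm]
    exact Finset.sum_const_nat fun b _ => if_pos b.2.2
  have hA₂ : ∑ b ∈ A₂.map (.subtype _), (if p b then 2 else 1) = A₂.card := by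
    rw [Finset.sum_map, ← mul_one A₂.card]
    exact Finset.sum_const_nat fun b _ => if_neg b.2.2
  have hle := hdem _ hsub
  rw [Finset.sum_union hdisj, hA₁, hA₂] at hle
  simpa [Finset.union_biUnion, Finset.map_eq_image, Finset.image_biUnion] using hle

theorem exists_two_matchings {t : β → Finset α} {B : Finset β} {p : β → Prop} [DecidablePred p]
    (hdem : ∀ A ⊆ B, ∑ b ∈ A, (if p b then 2 else 1) ≤ 2 * (A.biUnion t).card) :
    ∃ (D : Bool → Set β) (n : ∀ c, D c → α), (∀ c, Injective (n c)) ∧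
      (∀ c (b : D c), n c b ∈ t b) ∧ (∀ b ∈ B, p b → ∀ c, b ∈ D c) ∧ ∀ b ∈ B, ∃ c, b ∈ D c := by
  classical
  obtain ⟨h, hinj, hmem⟩ := (Finset.all_card_le_biUnion_card_iff_exists_injective
    (slots (κ := Bool) (fun b : {b // b ∈ B ∧ p b} => t b)
      fun b : {b // b ∈ B ∧ ¬ p b} => t b)).1 <|
    card_le_card_biUnion_slots (two_mul_card_add_card_le hdem)
  let owner : {b // b ∈ B ∧ p b} × Bool ⊕ {b // b ∈ B ∧ ¬ p b} → β :=
    Sum.elim (fun u => u.1) Subtype.val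
  have howner u : (h u).1 ∈ t (owner u) := by
    rcases u with u | u <;> exact (Finset.mem_product.1 (hmem _)).1
  choose v hvb hvc using fun (c : Bool) (b : {b | ∃ u, owner u = b ∧ (h u).2 = c}) => b.2
  refine ⟨_, fun c b => (h (v c b)).1, fun c b b' e => Subtype.ext ?_, fun c b => ?_,
    fun b hb hp c => ⟨Sum.inl (⟨b, hb, hp⟩, c), rfl, ?_⟩, fun b hb => ?_⟩
  · rw [← hvb c b, ← hvb c b', hinj (Prod.ext e ((hvc c b).trans (hvc c b').symm))]
  · simpa only [hvb] using howner (v c b)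
  · exact Finset.mem_singleton.1 (Finset.mem_product.1 (hmem (Sum.inl (⟨b, hb, hp⟩, c)))).2
  · by_cases hp : p b
    · exact ⟨_, Sum.inl (⟨b, hb, hp⟩, true), rfl, rfl⟩
    · exact ⟨_, Sum.inr ⟨b, hb, hp⟩, rfl, rfl⟩

theorem exists_matching_with_successor [Fintype β] {t : β → Finset α}
    (hall : ∀ A : Finset α, A.card ≤ (Finset.univ.filter fun b => ∃ a ∈ A, a ∈ t b).card)
    {B : Finset β} {p : β → Prop} [DecidablePred p]
    (hdem : ∀ A ⊆ B, ∑ b ∈ A, (if p b then 2 else 1) ≤ 2 * (A.biUnion t).card) :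
    ∃ (m : α → β) (f : β → β), Injective m ∧ (∀ a, a ∈ t (m a)) ∧
      (∀ b ∈ B, p b → b ∈ Set.range m) ∧ Set.InjOn f {b | b ∈ B ∧ (p b ∨ b ∉ Set.range m)} ∧
      ∀ b ∈ B, p b ∨ b ∉ Set.range m → ∃ a ∈ t b, m a = f b := by
  classical
  obtain ⟨D, n, hn, hnt, hp, hB⟩ := exists_two_matchings hdem
  obtain ⟨f, hf, hft⟩ := (Fintype.all_card_le_filter_rel_iff_exists_injective
    fun a b => a ∈ t b).1 hall
  obtain ⟨m, hm, hmt, hmD⟩ := exists_injective_subset_range (R := fun a b => a ∈ t b)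
    hf hft (hn true) (hnt true)
  have hD {b : β} (hb : b ∈ B) (hpm : p b ∨ b ∉ Set.range m) : b ∈ D false := by
    obtain hpb | hbm := hpm
    · exact hp b hb hpb false
    · obtain ⟨_ | _, hc⟩ := hB b hb
      · exact hc
      · exact absurd (hmD hc) hbm
  refine ⟨m, fun b => if h : b ∈ D false then m (n false ⟨b, h⟩) else b, hm, hmt,
    fun b hb hpb => hmD (hp b hb hpb true), fun b hb b' hb' h => ?_, fun b hb hpm => ?_⟩
  · simp only [dif_pos (hD hb.1 hb.2), dif_pos (hD hb'.1 hb'.2)] at h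
    exact congrArg Subtype.val (hn false (hm h))
  · exact ⟨n false ⟨b, hD hb hpm⟩, hnt false ⟨b, _⟩, by simp only [dif_pos (hD hb hpm)]⟩

end BipartiteMatchings

section ComponentBound

variable {W : Type*} {G : SimpleGraph V} {K : SimpleGraph W}

theorem card_filter_card_eq_le_numComponents [Finite W] (e : K ↪g G) {A : Finset V}
    (hA : (A : Set V) = Set.range e) {𝒞 : Finset (Finset V)} (h𝒞 : ∀ T ∈ 𝒞, IsComponent G A T)
    (i : ℕ) : (𝒞.filter fun T => T.card = i).card ≤ numComponents K i := by
  have hsub : ((↑) : Finset V → Set V) '' (𝒞.filter fun T => T.card = i) ⊆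
      (fun C : K.ConnectedComponent => e '' C.supp) '' {C | C.supp.ncard = i} := by
    rintro _ ⟨T, hT, rfl⟩
    obtain ⟨hT, hi⟩ := Finset.mem_filter.1 (Finset.mem_coe.1 hT)
    obtain ⟨C, hC⟩ := (h𝒞 T hT).exists_coe_eq_image_supp e hA
    refine ⟨C, ?_, hC.symm⟩
    rw [Set.mem_ofPred_eq, ← Set.ncard_image_of_injective _ e.injective, ← hC,
      Set.ncard_coe_finset, hi]
  rw [← Set.ncard_coe_finset, ← Set.ncard_image_of_injective _ Finset.coe_injective]
  exact (Set.ncard_le_ncard hsub).trans (Set.ncard_image_le (Set.toFinite _))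

theorem sum_weight (𝒞 : Finset (Finset V)) : ∑ T ∈ 𝒞, weight T =
    3 * (𝒞.filter fun T => T.card = 1).card + (𝒞.filter fun T => T.card = 3).card +
      (𝒞.filter fun T => T.card = 5).card := by
  simp only [Finset.card_filter]
  rw [Finset.mul_sum, ← Finset.sum_add_distrib, ← Finset.sum_add_distrib]
  refine Finset.sum_congr rfl fun T _ => ?_
  rw [weight]
  split_ifs <;> omega

variable [Fintype V] [DecidableEq V]

/-- The component condition of the theorem with denominators cleared, in terms of the vertex sets
of the components of `G - X`: their total weight is at most `2 * X.card`. -/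
def WeightBounded (G : SimpleGraph V) : Prop :=
  ∀ (X : Finset V) (𝒞 : Finset (Finset V)), (∀ T ∈ 𝒞, IsComponent G Xᶜ T) →
    ∑ T ∈ 𝒞, weight T ≤ 2 * X.card

theorem weightBounded_of_numComponents_le (hG : ∀ X : Set V,
    3 * numComponents (deleteVerts G X) 1 + numComponents (deleteVerts G X) 3 +
      numComponents (deleteVerts G X) 5 ≤ 2 * X.ncard) : WeightBounded G := by
  intro X 𝒞 h𝒞
  have hcount := card_filter_card_eq_le_numComponents (K := deleteVerts G X)
    (SimpleGraph.Embedding.induce (X : Set V)ᶜ)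
    ((Finset.coe_compl X).trans Subtype.range_coe.symm) h𝒞
  have hX := hG X
  rw [Set.ncard_coe_finset] at hX
  have := hcount 1
  have := hcount 3
  have := hcount 5
  rw [sum_weight]
  omega

theorem WeightBounded.sum_demand_le {ι : Type*} (hG : WeightBounded G) {A : Finset ι}
    {T : ι → Finset V} {N : Finset V} (hT : ∀ i ∈ A, IsComponentUnion G Nᶜ (T i))
    (hdisj : (A : Set ι).PairwiseDisjoint T) (hheavy : ∀ i ∈ A, Heavy G (T i)) :
    ∑ i ∈ A, demand (T i) ≤ 2 * N.card := by
  classical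
  choose! U hU 𝒞 h𝒞 hle using hheavy
  have hcomp : ∀ C ∈ A.biUnion 𝒞, IsComponent G (N ∪ A.biUnion U)ᶜ C := by
    intro C hC
    obtain ⟨i, hi, hCi⟩ := Finset.mem_biUnion.1 hC
    have hTU : T i \ A.biUnion U = T i \ U i := by
      refine (Finset.sdiff_subset_sdiff subset_rfl (Finset.subset_biUnion_of_mem U hi)).antisymm
        fun v hv => ?_
      simp only [Finset.mem_sdiff, Finset.mem_biUnion, not_exists, not_and] at hv ⊢
      refine ⟨hv.1, fun j hj hvj => ?_⟩
      obtain rfl := hdisj.elim_finset hi hj v hv.1 (hU j hj hvj)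
      exact hv.2 hvj
    rw [Finset.compl_union, ← Finset.sdiff_eq_inter_compl]
    exact (hT i hi).trans_isComponent (hTU ▸ h𝒞 i hi C hCi)
  have hdisj𝒞 : (A : Set ι).PairwiseDisjoint 𝒞 := by
    refine fun i hi j hj hij => Finset.disjoint_left.2 fun C hCi hCj => ?_
    obtain ⟨⟨v, hv⟩, hCT, -⟩ := (h𝒞 i hi C hCi).prop
    obtain ⟨-, hCT', -⟩ := (h𝒞 j hj C hCj).prop
    exact hij (hdisj.elim_finset hi hj v (Finset.mem_sdiff.1 (hCT hv)).1
      (Finset.mem_sdiff.1 (hCT' hv)).1)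
  have hweight := hG _ _ hcomp
  rw [Finset.sum_biUnion hdisj𝒞] at hweight
  have hsum := Finset.sum_le_sum hle
  rw [Finset.sum_add_distrib, ← Finset.mul_sum] at hsum
  have := Finset.card_union_le N (A.biUnion U)
  have := Finset.card_biUnion_le (s := A) (t := U)
  omega

end ComponentBound

section Chains

variable [DecidableEq V] {G : SimpleGraph V} {C D : Finset V}

theorem FactorCritical.matched_insert (h : FactorCritical G C) {s : V} (hs : s ∉ C)
    (hsC : Touches G s C) : Matched G (insert s C) := by
  obtain ⟨t, ht, hst⟩ := hsC
  have hdisj : Disjoint {s, t} (C.erase t) := by simp [hs]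
  convert (matched_pair hst).union (h.2 t ht) hdisj using 1
  rw [Finset.insert_union, ← Finset.insert_eq, Finset.insert_erase ht]

theorem FactorCritical.exists_path_three (h : FactorCritical G C) (hC : C.card ≠ 1) {c : V}
    (hc : c ∈ C) : ∃ x ∈ C, ∃ y ∈ C, [y, x, c].Nodup ∧ G.Adj c x ∧ G.Adj x y ∧
      Matched G (C \ {y, x, c}) := by
  obtain ⟨μ, hμ⟩ := h.2 c hc
  obtain ⟨_, hg, x, hx, hxc, hcx⟩ := h.exists_adj_notMem (Finset.singleton_subset_iff.2 hc)
    (Finset.singleton_nonempty c) (by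
      have := h.1.card_pos
      rw [Finset.card_singleton]
      omega)
  obtain rfl := Finset.mem_singleton.1 hg
  rw [Finset.mem_singleton] at hxc
  obtain ⟨h₁, h₂, h₃, h₄, h₅⟩ := hμ.mem_erase hx hxc
  refine ⟨x, hx, μ x, h₁, by simp [*], hcx, h₅, μ, ?_⟩
  have hrest := hμ.sdiff (B := {μ x, x}) (by simp [h₄])
  rwa [Finset.erase_eq, sdiff_sdiff_left, Finset.sup_eq_union, Finset.union_comm,
    Finset.insert_union, ← Finset.insert_eq] at hrest

theorem FactorCritical.pathTileable_union (h : FactorCritical G C) (hC : C.card ≠ 1) {c : V}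
    (hc : c ∈ C) {l : List V} (hl : l.length = 4) (hnd : l.Nodup) (hchain : (c :: l).IsChain G.Adj)
    {M : Finset V} (hM : Matched G M) (hlC : ∀ x ∈ l, x ∉ C) (hlM : ∀ x ∈ l, x ∉ M)
    (hCM : Disjoint C M) : PathTileable G (C ∪ (l.toFinset ∪ M)) := by
  obtain ⟨x, hx, y, hy, hnd', hcx, hxy, hrest⟩ := h.exists_path_three hC hc
  have hsub : {y, x, c} ⊆ C := by simp [Finset.insert_subset_iff, hx, hy, hc]
  have hseven := pathTileable_toFinset_union (l := [y, x] ++ c :: l) (by simp [hl]) (by grind)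
    (by simp [hxy.symm, hcx.symm, hchain]) (hrest.union hM (hCM.mono_left Finset.sdiff_subset)) (by
      have := Finset.disjoint_left.1 hCM
      simp only [List.mem_append, List.mem_cons, Finset.mem_union, Finset.mem_sdiff,
        Finset.mem_insert, Finset.mem_singleton]
      grind)
  convert hseven using 1
  ext v
  simp only [List.mem_append, List.mem_cons, List.mem_toFinset, Finset.mem_union,
    Finset.mem_sdiff, Finset.mem_insert, Finset.mem_singleton]
  grind

theorem FactorCritical.pathTileable_union_insert (hC : FactorCritical G C) (hC₁ : C.card ≠ 1)
    (hD : FactorCritical G D) (hD₁ : D.card ≠ 1) (hCD : Disjoint C D) {s : V} (hsC : s ∉ C)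
    (hsD : s ∉ D) (hC' : Touches G s C) (hD' : Touches G s D) :
    PathTileable G (C ∪ insert s D) := by
  obtain ⟨c, hc, hsc⟩ := hC'
  obtain ⟨d, hd, hsd⟩ := hD'
  obtain ⟨x, hx, y, hy, hnd, hdx, hxy, hrest⟩ := hD.exists_path_three hD₁ hd
  have hsub : {y, x, d} ⊆ D := by simp [Finset.insert_subset_iff, hx, hy, hd]
  have hunion : insert s D = [s, d, x, y].toFinset ∪ D \ {y, x, d} := by
    nth_rw 1 [← Finset.union_sdiff_of_subset hsub]
    ext v
    simp only [List.mem_toFinset, List.mem_cons, Finset.mem_insert, Finset.mem_union,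
      Finset.mem_singleton, List.not_mem_nil]
    tauto
  have hdisj := Finset.disjoint_right.1 hCD
  rw [hunion]
  exact hC.pathTileable_union hC₁ hc rfl (by grind)
    (by simp [hsc.symm, hsd, hdx, hxy]) hrest (by grind) (by grind)
    (hCD.mono_right Finset.sdiff_subset)

theorem FactorCritical.pathTileable_union_insert_singleton (hC : FactorCritical G C)
    (hC₁ : C.card ≠ 1) (hD : FactorCritical G D) (hCD : Disjoint C D) {s t r : V} (hsr : s ≠ r)
    (hC' : ∀ v ∈ [s, t, r], v ∉ C) (hD' : ∀ v ∈ [s, t, r], v ∉ D) (hsC : Touches G s C)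
    (hst : G.Adj s t) (hrt : G.Adj r t) (hrD : Touches G r D) :
    PathTileable G (C ∪ (insert s {t} ∪ insert r D)) := by
  obtain ⟨c, hc, hsc⟩ := hsC
  obtain ⟨d, hd, hrd⟩ := hrD
  have hunion : insert s {t} ∪ insert r D = [s, t, r, d].toFinset ∪ D.erase d := by
    nth_rw 1 [← Finset.insert_erase hd]
    ext v
    simp only [List.mem_toFinset, List.mem_cons, Finset.mem_insert, Finset.mem_union,
      Finset.mem_singleton, List.not_mem_nil]
    tauto
  have hdisj := Finset.disjoint_right.1 hCD
  have := hst.ne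
  have := hrt.ne
  rw [hunion]
  exact hC.pathTileable_union hC₁ hc rfl (by grind)
    (by simp [hsc.symm, hst, hrt.symm, hrd]) (hD.2 d hd) (by grind) (by grind)
    (hCD.mono_right (Finset.erase_subset d D))

end Chains

theorem Tileable.biUnion_of_groups [DecidableEq V] {𝓗 : Set (Σ n : ℕ, SimpleGraph (Fin n))}
    {G : SimpleGraph V} {ι κ : Type*} {A : ι → Finset V} {I : Finset ι}
    (hA : (I : Set ι).PairwiseDisjoint A) {E : Finset κ} {J : κ → Finset ι}
    (hJI : ∀ e ∈ E, J e ⊆ I) (hJ : (E : Set κ).PairwiseDisjoint J)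
    (hE : ∀ e ∈ E, Tileable 𝓗 G ((J e).biUnion A))
    (hrest : ∀ i ∈ I, (∀ e ∈ E, i ∉ J e) → Tileable 𝓗 G (A i)) : Tileable 𝓗 G (I.biUnion A) := by
  classical
  have hsub : E.biUnion J ⊆ I := Finset.biUnion_subset.2 hJI
  have hdisj : ∀ K ⊆ I, ∀ L ⊆ I, Disjoint K L → Disjoint (K.biUnion A) (L.biUnion A) :=
    fun K hK L hL hKL => (Finset.disjoint_biUnion_left _ _ _).2 fun i hi =>
      (Finset.disjoint_biUnion_right _ _ _).2 fun j hj =>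
        hA (hK hi) (hL hj) (Finset.disjoint_iff_ne.1 hKL i hi j hj)
  rw [← Finset.union_sdiff_of_subset hsub, Finset.union_biUnion, Finset.biUnion_biUnion]
  refine (Tileable.biUnion hE fun e he e' he' hne =>
    hdisj _ (hJI e he) _ (hJI e' he') (hJ he he' hne)).union
      (Tileable.biUnion (fun i hi => ?_) (hA.subset (by simp))) ?_
  · rw [Finset.mem_sdiff, Finset.mem_biUnion] at hi
    exact hrest i hi.1 fun e he hie => hi.2 ⟨e, he, hie⟩
  · rw [← Finset.biUnion_biUnion]
    exact hdisj _ hsub _ Finset.sdiff_subset Finset.disjoint_sdiff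

section Linkages

variable {ι : Type*} {G : SimpleGraph V} {S : Finset V}
  {T : ι → Finset V} {B : Finset ι} {m : S → ι} {f : ι → ι}

/-- The parts in `B` that ask for a successor: the singletons and the parts not matched by `m`. -/
def Seeking (T : ι → Finset V) (B : Finset ι) (m : S → ι) : Set ι :=
  {i | i ∈ B ∧ ((T i).card = 1 ∨ i ∉ Set.range m)}

variable [DecidableEq ι]

/-- The indices of the bags covered by the chain that starts at the unmatched part `T i`. The
chain passes through its successor, and stops there unless the successor is a singleton. -/
def chain (T : ι → Finset V) (f : ι → ι) (i : ι) : Finset ι :=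
  if (T (f i)).card = 1 then {i, f i, f (f i)} else {i, f i}

theorem mem_chain {i j : ι} :
    j ∈ chain T f i ↔ j = i ∨ j = f i ∨ (T (f i)).card = 1 ∧ j = f (f i) := by
  rw [chain]
  split_ifs with h <;> simp [h]

variable [DecidableEq V]

/-- A linkage of the barrier `S` with the disjoint factor-critical parts `T i`. The set `B` contains
every part without a tiling, the matching `m` sends the vertices of `S` to parts they touch, and
every part `T i` that seeks a successor touches a vertex matched by `m` to its successor
`T (f i)`. -/
structure IsLinkage (G : SimpleGraph V) (T : ι → Finset V) (B : Finset ι) (m : S → ι)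
    (f : ι → ι) : Prop where
  factorCritical (i : ι) : FactorCritical G (T i)
  disjoint : Pairwise (Disjoint on T)
  notMem (s : S) (i : ι) : (s : V) ∉ T i
  mem_of_card_eq_one {i : ι} (hi : (T i).card = 1) : i ∈ B
  pathTileable {i : ι} (hi : i ∉ B) : PathTileable G (T i)
  injective : Injective m
  touches (s : S) : Touches G s (T (m s))
  mem_range_of_card_eq_one {i : ι} (hi : (T i).card = 1) : i ∈ Set.range m
  injOn : Set.InjOn f (Seeking T B m)
  exists_touches {i : ι} (hi : i ∈ Seeking T B m) : ∃ s : S, Touches G s (T i) ∧ m s = f i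

/-- The part `T i`, together with the vertex of the barrier matched to it, if there is one. -/
def bag (T : ι → Finset V) (m : S → ι) (i : ι) : Finset V :=
  (Finset.univ.filter fun s => m s = i).map (Embedding.subtype _) ∪ T i

theorem bag_of_notMem_range {i : ι} (hi : i ∉ Set.range m) : bag T m i = T i := by
  rw [bag, Finset.filter_false_of_mem fun s _ hs => hi ⟨s, hs⟩, Finset.map_empty,
    Finset.empty_union]

theorem bag_apply (hm : Injective m) (s : S) : bag T m (m s) = insert (s : V) (T (m s)) := by
  simp [bag, hm.eq_iff, Finset.filter_eq']

theorem biUnion_bag [Fintype ι] : Finset.univ.biUnion (bag T m) = S ∪ Finset.univ.biUnion T := by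
  ext v
  simp [bag, exists_or]

namespace IsLinkage

theorem pairwise_disjoint_bag (h : IsLinkage G T B m f) : Pairwise (Disjoint on bag T m) := by
  intro i j hij
  rw [Function.onFun, Finset.disjoint_left]
  intro v hvi hvj
  simp only [bag, Finset.mem_union, Finset.mem_map, Finset.mem_filter] at hvi hvj
  rcases hvi with ⟨s, ⟨-, rfl⟩, rfl⟩ | hvi <;> rcases hvj with ⟨s', ⟨-, rfl⟩, e⟩ | hvj
  · exact hij (congrArg m (Subtype.ext e)).symm
  · exact h.notMem s j hvj
  · subst e
    exact h.notMem s' i hvi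
  · exact Finset.disjoint_left.1 (h.disjoint hij) hvi hvj

theorem pairwiseDisjoint_chain (h : IsLinkage G T B m f) :
    {i | i ∈ B ∧ i ∉ Set.range m}.PairwiseDisjoint (chain T f) := by
  have hseek {i} (hi : i ∈ B ∧ i ∉ Set.range m) : i ∈ Seeking T B m := ⟨hi.1, Or.inr hi.2⟩
  have hseek' {i} (hi : (T (f i)).card = 1) : f i ∈ Seeking T B m :=
    ⟨h.mem_of_card_eq_one hi, Or.inl hi⟩
  have hstart {i j} (hi : i ∈ B ∧ i ∉ Set.range m) (hj : j ∈ Seeking T B m) : i ≠ f j := by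
    rintro rfl
    exact hi.2 ((h.exists_touches hj).imp fun _ hs => hs.2)
  have hnext {i j} (hi : i ∈ B ∧ i ∉ Set.range m) (hj : (T (f j)).card = 1) : f i ≠ f (f j) :=
    fun e => hi.2 (h.injOn (hseek hi) (hseek' hj) e ▸ h.mem_range_of_card_eq_one hj)
  intro i hi i' hi' hne
  rw [Function.onFun, Finset.disjoint_left]
  intro j hj hj'
  rw [mem_chain] at hj hj'
  rcases hj with rfl | rfl | ⟨h₁, rfl⟩ <;> rcases hj' with e | e | ⟨h₂, e⟩
  · exact hne e
  · exact hstart hi (hseek hi') e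
  · exact hstart hi (hseek' h₂) e
  · exact hstart hi' (hseek hi) e.symm
  · exact hne (h.injOn (hseek hi) (hseek hi') e)
  · exact hnext hi h₂ e
  · exact hstart hi' (hseek' h₁) e.symm
  · exact hnext hi' h₁ e.symm
  · exact hne (h.injOn (hseek hi) (hseek hi') (h.injOn (hseek' h₁) (hseek' h₂) e))

theorem pathTileable_chain (h : IsLinkage G T B m f) {i : ι} (hi : i ∈ B)
    (him : i ∉ Set.range m) : PathTileable G ((chain T f i).biUnion (bag T m)) := by
  have hi₁ : (T i).card ≠ 1 := fun hi₁ => him (h.mem_range_of_card_eq_one hi₁)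
  have hsi : i ∈ Seeking T B m := ⟨hi, Or.inr him⟩
  obtain ⟨s, hs, hsf⟩ := h.exists_touches hsi
  have hif (s : S) : i ≠ m s := fun e => him ⟨s, e.symm⟩
  by_cases hf : (T (f i)).card = 1
  · have hsf' : f i ∈ Seeking T B m := ⟨h.mem_of_card_eq_one hf, Or.inl hf⟩
    obtain ⟨r, ⟨t, ht, hrt⟩, hrf⟩ := h.exists_touches hsf'
    have hTt : T (f i) = {t} := by
      obtain ⟨u, hu⟩ := Finset.card_eq_one.1 hf
      rw [hu] at ht ⊢
      rw [Finset.mem_singleton.1 ht]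
    have hst : G.Adj s t := by simpa [Touches, hsf, hTt] using h.touches s
    have hsr : s ≠ r := by
      rintro rfl
      exact him ⟨s, hsf.trans (h.injOn hsf' hsi (hrf.symm.trans hsf))⟩
    have ht' {j} (hj : f i ≠ j) : t ∉ T j := Finset.disjoint_left.1 (h.disjoint hj) ht
    simp only [chain, if_pos hf, Finset.biUnion_insert, Finset.singleton_biUnion, ← hrf]
    rw [bag_of_notMem_range him, ← hsf, bag_apply h.injective, bag_apply h.injective, hsf, hTt]
    refine (h.factorCritical i).pathTileable_union_insert_singleton hi₁ (h.factorCritical _)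
      (h.disjoint (hif r)) (fun e => hsr (Subtype.ext e)) ?_ ?_ hs hst hrt (h.touches r)
    · simp [h.notMem, ht' (hsf ▸ (hif s).symm)]
    · simp [h.notMem, ht' (hsf ▸ h.injective.ne hsr)]
  · simp only [chain, if_neg hf, Finset.biUnion_insert, Finset.singleton_biUnion]
    rw [bag_of_notMem_range him, ← hsf, bag_apply h.injective]
    exact (h.factorCritical i).pathTileable_union_insert hi₁ (h.factorCritical _) (hsf ▸ hf)
      (h.disjoint (hif s)) (h.notMem s i) (h.notMem s _) hs (h.touches s)

theorem pathTileable_biUnion_bag [Fintype ι] (h : IsLinkage G T B m f) :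
    PathTileable G (Finset.univ.biUnion (bag T m)) := by
  classical
  refine Tileable.biUnion_of_groups (h.pairwise_disjoint_bag.set_pairwise _)
    (E := B.filter (· ∉ Set.range m)) (J := chain T f) (fun _ _ => Finset.subset_univ _)
    (by simpa using h.pairwiseDisjoint_chain) (fun i hi => ?_) fun i _ hi => ?_
  · rw [Finset.mem_filter] at hi
    exact h.pathTileable_chain hi.1 hi.2
  · by_cases him : i ∈ Set.range m
    · obtain ⟨s, rfl⟩ := him
      rw [bag_apply h.injective]
      exact ((h.factorCritical _).matched_insert (h.notMem s _) (h.touches s)).pathTileable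
    · rw [bag_of_notMem_range him]
      exact h.pathTileable fun hiB => hi i (Finset.mem_filter.2 ⟨hiB, him⟩)
        (mem_chain.2 (Or.inl rfl))

end IsLinkage

end Linkages

section Assembly

variable {G : SimpleGraph V}

/-- The vertices of `S` that are adjacent to some vertex of `A`, as a set of vertices of the
subtype `S`. -/
noncomputable def attachments (G : SimpleGraph V) (S A : Finset V) : Finset S :=
  open Classical in Finset.univ.filter fun s => Touches G s A

theorem mem_attachments {S A : Finset V} {s : S} : s ∈ attachments G S A ↔ Touches G s A := by
  simp [attachments]

variable [DecidableEq V]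

theorem FactorCritical.heavy {A : Finset V} (h : FactorCritical G A)
    (hA : A.card = 1 ∨ ¬ PathTileable G A) : Heavy G A := by
  by_cases hcard : A.card < 7
  · exact h.heavy_of_card_lt hcard
  · exact h.heavy_of_not_pathTileable (by omega) (hA.resolve_left (by omega))

variable [Fintype V] {S : Finset V} {𝒯 : Finset (Finset V)}

namespace IsMaximalBarrier

theorem card_le_card_attachments (h : IsMaximalBarrier G S 𝒯) (A : Finset S) :
    A.card ≤ (Finset.univ.filter fun C : 𝒯 => ∃ s ∈ A, s ∈ attachments G S C).card := by
  classical
  have hle := h.card_le_card_touches (A := A.map (Embedding.subtype _)) fun v hv => by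
    obtain ⟨s, -, rfl⟩ := Finset.mem_map.1 hv
    exact s.2
  rw [Finset.card_map] at hle
  refine hle.trans (Finset.card_le_card_of_surjOn Subtype.val fun C hC => ?_)
  obtain ⟨hC, a, ha, haC⟩ := Finset.mem_filter.1 (Finset.mem_coe.1 hC)
  obtain ⟨s, hs, rfl⟩ := Finset.mem_map.1 ha
  exact ⟨⟨C, hC⟩, Finset.mem_coe.2 (Finset.mem_filter.2
    ⟨Finset.mem_univ _, s, hs, mem_attachments.2 haC⟩), rfl⟩

theorem sum_demand_le (h : IsMaximalBarrier G S 𝒯) (hG : WeightBounded G) {A : Finset 𝒯}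
    (hA : ∀ C ∈ A, Heavy G C.1) :
    ∑ C ∈ A, demand C.1 ≤ 2 * (A.biUnion fun C => attachments G S C).card := by
  rw [← Finset.card_map (Embedding.subtype _)]
  refine hG.sum_demand_le (fun C hC => ?_)
    (fun C _ D _ hCD => h.oddParts.2 C.2 D.2 (Subtype.coe_injective.ne hCD)) hA
  obtain ⟨hCS, hclosed⟩ := (h.oddParts.1 C C.2).1
  refine ⟨fun x hx => Finset.mem_compl.2 fun hxN => ?_, fun x hx y hy hxy => ?_⟩
  · obtain ⟨s, -, rfl⟩ := Finset.mem_map.1 hxN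
    exact Finset.mem_compl.1 (hCS hx) s.2
  · refine hclosed x hx y (Finset.mem_compl.2 fun hyS => Finset.mem_compl.1 hy ?_) hxy
    exact Finset.mem_map.2 ⟨⟨y, hyS⟩,
      Finset.mem_biUnion.2 ⟨C, hC, mem_attachments.2 ⟨x, hx, hxy.symm⟩⟩, rfl⟩

theorem exists_isLinkage (h : IsMaximalBarrier G S 𝒯) (hG : WeightBounded G) :
    ∃ (B : Finset 𝒯) (m : S → 𝒯) (f : 𝒯 → 𝒯),
      IsLinkage G (Subtype.val : 𝒯 → Finset V) B m f := by
  classical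
  let B : Finset 𝒯 := Finset.univ.filter fun C => C.1.card = 1 ∨ ¬ PathTileable G C.1
  have hB {C : 𝒯} : C ∈ B ↔ C.1.card = 1 ∨ ¬ PathTileable G C.1 := by simp [B]
  obtain ⟨m, f, hm, htouches, hrange, hinj, hf⟩ :=
    exists_matching_with_successor h.card_le_card_attachments (B := B) fun A hA =>
      h.sum_demand_le hG fun C hC => (h.factorCritical C.2).heavy (hB.1 (hA hC))
  exact ⟨B, m, f, {
    factorCritical := fun C => h.factorCritical C.2
    disjoint := fun C D hCD => h.oddParts.2 C.2 D.2 (Subtype.coe_injective.ne hCD)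
    notMem := fun s C hs => Finset.mem_compl.1 ((h.oddParts.1 C C.2).1.1 hs) s.2
    mem_of_card_eq_one := fun hC => hB.2 (Or.inl hC)
    pathTileable := fun hC => by_contra fun hC' => hC (hB.2 (Or.inr hC'))
    injective := hm
    touches := fun s => mem_attachments.1 (htouches s)
    mem_range_of_card_eq_one := fun hC => hrange _ (hB.2 (Or.inl hC)) hC
    injOn := hinj
    exists_touches := fun hC =>
      (hf _ hC.1 hC.2).imp fun s hs => ⟨mem_attachments.1 hs.1, hs.2⟩ }⟩

end IsMaximalBarrier

theorem WeightBounded.pathTileable_univ (hG : WeightBounded G) :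
    PathTileable G Finset.univ := by
  obtain ⟨S, 𝒯, h⟩ := exists_isMaximalBarrier G
  obtain ⟨B, m, f, hlink⟩ := h.exists_isLinkage hG
  have hbags := hlink.pathTileable_biUnion_bag
  have hunion : Finset.univ.biUnion (Subtype.val : 𝒯 → Finset V) = 𝒯.biUnion id := by
    ext v
    simp
  rw [biUnion_bag, hunion] at hbags
  have hrest := h.matched_rest
  rw [Finset.compl_eq_univ_sdiff, sdiff_sdiff_left] at hrest
  rw [← Finset.union_sdiff_of_subset (Finset.subset_univ (S ∪ 𝒯.biUnion id))]
  exact hbags.union hrest.pathTileable Finset.disjoint_sdiff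

end Assembly

end PathFactor

theorem theorem1p1 {V : Type*} [Finite V] (G : SimpleGraph V)
    (hG : ∀ X : Set V,
      (PathFactor.numComponents (PathFactor.deleteVerts G X) 1 : ℝ)
        + (1 / 3 : ℝ) * (PathFactor.numComponents (PathFactor.deleteVerts G X) 3 : ℝ)
        + (1 / 3 : ℝ) * (PathFactor.numComponents (PathFactor.deleteVerts G X) 5 : ℝ)
        ≤ (2 / 3 : ℝ) * (X.ncard : ℝ)) :
    ∃ F : SimpleGraph V, PathFactor.IsFactor {PathFactor.path 2, PathFactor.path 7} G F := by
  classical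
  have := Fintype.ofFinite V
  have hbound : PathFactor.WeightBounded G :=
    PathFactor.weightBounded_of_numComponents_le fun X => by
      have := hG X
      rify
      linarith
  refine hbound.pathTileable_univ.exists_isFactor ?_
  rintro _ (rfl | rfl) <;> exact SimpleGraph.pathGraph_connected _
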